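/- Let $X$ be a real Banach space whose dual $X^{*}$ is strictly convex, and let $K\subseteq X$ be a Čebyšev set, that is, every $x\in X$ has exactly one nearest point $\overline{x}\in K$, i.e. exactly one $\overline{x}\in K$ with $\|x-\overline{x}\|=d_K(x):=\inf_{v\in K}\|x-v\|$. For $x,y\in X$ let $$d_K^{-}(x;y)=\liminf_{t\to 0^{+}}\frac{d_K(x+ty)-d_K(x)}{t}$$ be the lower Dini derivative of the distance function at $x$ in the direction $y$. If $$d_K^{-}(x;x-\overline{x})=d_K(x)\qquad\text{for every }x\in X\setminus K,$$ then $K$ is convex. -/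

import Mathlib

open Filter Topology

/-- `p` is a nearest point of `x` in `K`: it lies in `K` and `‖x - p‖ = d_K(x)`, where
`d_K(x) = inf {‖x - v‖ : v ∈ K}` is `Metric.infDist x K`. -/
def IsNearestPoint {X : Type*} [NormedAddCommGroup X] (K : Set X) (x p : X) : Prop :=
  p ∈ K ∧ ‖x - p‖ = Metric.infDist x K

/-- `K` is a Chebyshev set: every point of the space has a unique nearest point in `K`.
(Such a `K` is automatically nonempty and closed.) -/
def IsChebyshevSet {X : Type*} [NormedAddCommGroup X] (K : Set X) : Prop :=
  ∀ x : X, ∃! p : X, IsNearestPoint K x p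

/-- The lower Dini derivative of the distance function `d_K` at `x` in the direction `y`,
`liminf_{t → 0⁺} (d_K(x + t y) - d_K(x)) / t`. The quotients lie in `[-‖y‖, ‖y‖]` for `t > 0`,
see `abs_distQuotient_le`, so that the real-valued lower limit is the true one. -/
noncomputable def lowerDiniDist {X : Type*} [NormedAddCommGroup X] [NormedSpace ℝ X]
    (K : Set X) (x y : X) : ℝ :=
  liminf (fun t : ℝ => (Metric.infDist (x + t • y) K - Metric.infDist x K) / t) (𝓝[>] 0)

theorem abs_distQuotient_le {X : Type*} [NormedAddCommGroup X] [NormedSpace ℝ X]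
    (K : Set X) (x y : X) {t : ℝ} (ht : 0 < t) :
    |(Metric.infDist (x + t • y) K - Metric.infDist x K) / t| ≤ ‖y‖ := by
  have h := (Metric.lipschitz_infDist_pt K).dist_le_mul (x + t • y) x
  rw [Real.dist_eq, dist_eq_norm, add_sub_cancel_left, norm_smul, Real.norm_of_nonneg ht.le] at h
  rw [abs_div, abs_of_pos ht, div_le_iff₀ ht]
  simpa [mul_comm] using h

/-!
Suppose some point `x` of a segment between two points of `K` is not in `K`. Write `d` for the
distance function of `K`.

The hypothesis says that at every point `w` outside `K` the function `d`, which is `1`-Lipschitz,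
grows at the maximal rate `1` in the direction `w - p`, where `p` is the nearest point of `w`.
Ekeland's variational principle (`exists_ekeland_maximal`) turns this local growth into growth at
unit scale: if `d z > r ≥ 0`, some `z'` with `dist z' z ≤ 1` has `d z' > r + 1`
(`exists_infDist_gt_add_one`). Iteration from `x` gives centres `z n` with consecutive distances at
most `1` and `d (z n) > r + n`, where `0 < r < d x`. The balls with centres `z n` and radii `r + n`
increase and miss `K`; hence so does their union `U`, which contains `x`.

Strict convexity of the dual now makes the complement of `U` convex, by an argument of Vlasov
(`convex_compl_iUnion_ball`): any two norm-one functionals bounded above on `U` almost attain their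
norm at the same vectors `z 0 - z n`, so that their sum has norm `2` and they coincide. Hence the
functionals that separate two given points from `U` can be taken equal, and separate the segment
between them as well. The segment therefore stays in the complement of `U`, which contradicts `x ∈ U`.
-/

/-- **Ekeland's variational principle**, for a continuous function `φ` that is bounded above: above
every `z` there is a maximal element `w` for the order
`u ≼ v ↔ σ * dist u v ≤ φ v - φ u`. -/
theorem exists_ekeland_maximal {M : Type*} [MetricSpace M] [CompleteSpace M] {φ : M → ℝ}
    (hφ : Continuous φ) (hb : BddAbove (Set.range φ)) {σ : ℝ} (hσ : 0 < σ) (z : M) :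
    ∃ w, σ * dist z w ≤ φ w - φ z ∧ ∀ v, σ * dist w v ≤ φ v - φ w → v = w := by
  have htrans : ∀ {u v w : M}, σ * dist u v ≤ φ v - φ u → σ * dist v w ≤ φ w - φ v →
      σ * dist u w ≤ φ w - φ u := by
    intro u v w h₁ h₂
    nlinarith [dist_triangle u v w]
  -- Each step gains at least half of what can still be gained.
  have hnext : ∀ w, ∃ w', σ * dist w w' ≤ φ w' - φ w ∧
      ∀ v, σ * dist w v ≤ φ v - φ w → φ v + φ w ≤ 2 * φ w' := by
    intro w
    set A : Set ℝ := φ '' {v | σ * dist w v ≤ φ v - φ w}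
    have hA : BddAbove A := hb.mono (Set.image_subset_range _ _)
    have hwA : φ w ∈ A := ⟨w, by simp, rfl⟩
    by_cases h : sSup A ≤ φ w
    · refine ⟨w, by simp, fun v hv => ?_⟩
      have := le_csSup hA ⟨v, hv, rfl⟩
      linarith
    · have h' : (φ w + sSup A) / 2 < sSup A := by linarith
      obtain ⟨_, ⟨w', hw', rfl⟩, hlt⟩ := exists_lt_of_lt_csSup ⟨_, hwA⟩ h'
      refine ⟨w', hw', fun v hv => ?_⟩
      have := le_csSup hA ⟨v, hv, rfl⟩
      linarith
  choose next hn₁ hn₂ using hnext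
  let u : ℕ → M := fun n => next^[n] z
  have hu : ∀ n, u (n + 1) = next (u n) := fun n => Function.iterate_succ_apply' next n z
  have hmn : ∀ m n, m ≤ n → σ * dist (u m) (u n) ≤ φ (u n) - φ (u m) := by
    intro m n h
    induction n, h using Nat.le_induction with
    | base => simp
    | succ k _ ih => exact htrans ih (by rw [hu]; exact hn₁ _)
  have hmono : Monotone (φ ∘ u) := fun m n h => by
    have h₁ := hmn m n h
    have h₂ : 0 ≤ σ * dist (u m) (u n) := by positivity
    simp only [Function.comp]
    linarith
  have hlim := tendsto_atTop_ciSup hmono (hb.mono (Set.range_comp_subset_range u φ))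
  set L := ⨆ n, (φ ∘ u) n
  have hle : ∀ n, φ (u n) ≤ L := fun n => hmono.ge_of_tendsto hlim n
  have hcau : CauchySeq u := by
    refine cauchySeq_of_le_tendsto_0' (fun n => (L - φ (u n)) / σ) (fun m n h => ?_) ?_
    · rw [le_div_iff₀ hσ]
      linarith [hmn m n h, hle n]
    · simpa using (hlim.const_sub L).div_const σ
  obtain ⟨w, hw⟩ := cauchySeq_tendsto_of_complete hcau
  have hφw : Tendsto (fun n => φ (u n)) atTop (𝓝 (φ w)) := (hφ.tendsto w).comp hw
  have hwn : ∀ n, σ * dist (u n) w ≤ φ w - φ (u n) := fun n =>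
    le_of_tendsto_of_tendsto ((tendsto_const_nhds.dist hw).const_mul σ) (hφw.sub_const _)
      (eventually_atTop.2 ⟨n, fun m hm => hmn n m hm⟩)
  refine ⟨w, hwn 0, fun v hv => ?_⟩
  have hbound : ∀ n, φ v + φ (u n) ≤ 2 * φ (u (n + 1)) := fun n => by
    rw [hu]
    exact hn₂ _ v (htrans (hwn n) hv)
  have h₁ : φ v + φ w ≤ 2 * φ w :=
    le_of_tendsto_of_tendsto' (hφw.const_add _)
      ((hφw.comp (tendsto_add_atTop_nat 1)).const_mul 2) hbound
  have h₂ : dist w v ≤ 0 := by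
    by_contra! h
    have := mul_pos hσ h
    linarith
  exact (dist_le_zero.1 h₂).symm

section Growth

variable {X : Type*} [NormedAddCommGroup X] [NormedSpace ℝ X] {K : Set X}

/-- A lower Dini derivative exceeding `c` gives arbitrarily short steps along which the distance
to `K` grows at a rate exceeding `c`. -/
theorem exists_step_of_lt_lowerDiniDist {x y : X} {c ε : ℝ} (h : c < lowerDiniDist K x y)
    (hε : 0 < ε) :
    ∃ t, 0 < t ∧ t < ε ∧ Metric.infDist x K + c * t < Metric.infDist (x + t • y) K := by
  have hpos : ∀ᶠ t : ℝ in 𝓝[>] 0, 0 < t := self_mem_nhdsWithin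
  have hbdd : IsBoundedUnder (· ≥ ·) (𝓝[>] (0 : ℝ))
      (fun t : ℝ => (Metric.infDist (x + t • y) K - Metric.infDist x K) / t) :=
    ⟨-‖y‖, eventually_map.2 (hpos.mono fun t ht => (abs_le.1 (abs_distQuotient_le K x y ht)).1)⟩
  obtain ⟨t, ht, ht₀, htε⟩ := ((eventually_lt_of_lt_liminf h hbdd).and
    (hpos.and (nhdsWithin_le_nhds (Iio_mem_nhds hε)))).exists
  refine ⟨t, ht₀, htε, ?_⟩
  rw [lt_div_iff₀ ht₀] at ht
  linarith

/-- Unit-scale growth of the distance function: from a point outside `K` one can move by at most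
`1` and gain more than any prescribed amount less than `1`. -/
theorem exists_infDist_gt_add_one [CompleteSpace X] (hK : IsChebyshevSet K)
    (hDini : ∀ x : X, x ∉ K → ∀ p : X, IsNearestPoint K x p →
      lowerDiniDist K x (x - p) = Metric.infDist x K)
    {z : X} {r : ℝ} (hr : 0 ≤ r) (hz : r < Metric.infDist z K) :
    ∃ z', dist z' z ≤ 1 ∧ r + 1 < Metric.infDist z' K := by
  obtain ⟨σ, hσ, hσ₁⟩ := exists_between
    (max_lt zero_lt_one (sub_lt_self 1 (sub_pos.2 hz)) :
      max 0 (1 - (Metric.infDist z K - r)) < 1)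
  obtain ⟨hσ₀, hσr⟩ := max_lt_iff.1 hσ
  have hcont : Continuous fun v : Metric.closedBall z (1 : ℝ) => Metric.infDist (v : X) K :=
    (Metric.continuous_infDist_pt K).comp continuous_subtype_val
  have hbdd : BddAbove (Set.range fun v : Metric.closedBall z (1 : ℝ) =>
      Metric.infDist (v : X) K) := by
    refine ⟨Metric.infDist z K + 1, ?_⟩
    rintro _ ⟨v, rfl⟩
    exact Metric.infDist_le_infDist_add_dist.trans (by gcongr; exact v.2)
  have : CompleteSpace (Metric.closedBall z (1 : ℝ)) :=
    Metric.isClosed_closedBall.completeSpace_coe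
  obtain ⟨⟨w, hwz⟩, hw, hmax⟩ := exists_ekeland_maximal hcont hbdd hσ₀
    ⟨z, Metric.mem_closedBall_self zero_le_one⟩
  simp only [Subtype.dist_eq, Subtype.forall, Subtype.mk.injEq] at hw hmax
  refine ⟨w, hwz, ?_⟩
  -- The maximal element lies on the unit sphere: otherwise one could move on from it.
  have hsphere : dist w z = 1 := by
    refine le_antisymm hwz (not_lt.1 fun hlt => ?_)
    have hd : 0 < Metric.infDist w K := by
      have : 0 ≤ σ * dist z w := by positivity
      linarith
    have hwK : w ∉ K := fun h => hd.ne' (Metric.infDist_zero_of_mem h)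
    obtain ⟨p, hp, -⟩ := hK w
    have hwp : ‖w - p‖ = Metric.infDist w K := hp.2
    obtain ⟨t, ht₀, htε, ht⟩ := exists_step_of_lt_lowerDiniDist
      (c := σ * Metric.infDist w K) (ε := (1 - dist w z) / Metric.infDist w K)
      (by rw [hDini w hwK p hp]; nlinarith) (div_pos (by linarith) hd)
    rw [lt_div_iff₀ hd] at htε
    have hdist : dist w (w + t • (w - p)) = t * Metric.infDist w K := by
      rw [dist_self_add_right, norm_smul, hwp, Real.norm_of_nonneg ht₀.le]
    have hv := hmax (w + t • (w - p))
      (Metric.mem_closedBall.2 <| by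
        linarith [dist_triangle_left (w + t • (w - p)) z w])
      (by rw [hdist]; linarith)
    rw [hv, dist_self] at hdist
    exact (mul_pos ht₀ hd).ne hdist
  rw [dist_comm, hsphere] at hw
  linarith

end Growth

section Vlasov

variable {X : Type*} [NormedAddCommGroup X] [NormedSpace ℝ X]

theorem ContinuousLinearMap.apply_add_norm_mul_le_of_ball {f : StrongDual ℝ X} {z : X} {r c : ℝ}
    (hr : 0 < r) (h : ∀ y ∈ Metric.ball z r, f y ≤ c) : f z + ‖f‖ * r ≤ c := by
  by_contra! hlt
  have hlt' : (c - f z) / r < ‖f‖ := by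
    rw [div_lt_iff₀ hr]
    linarith
  obtain ⟨x, hx, hfx⟩ := f.exists_lt_apply_of_lt_opNorm hlt'
  rw [div_lt_iff₀ hr, Real.norm_eq_abs] at hfx
  have hrx : ‖r • x‖ < r := by
    rw [norm_smul, Real.norm_of_nonneg hr.le]
    exact mul_lt_of_lt_one_right hr hx
  have h₁ := h (z + r • x) (by simpa using hrx)
  have h₂ := h (z - r • x) (by simpa [dist_eq_norm] using hrx)
  simp only [map_add, map_sub, map_smul, smul_eq_mul] at h₁ h₂
  rcases abs_cases (f x) with ⟨he, -⟩ | ⟨he, -⟩ <;> rw [he] at hfx <;> linarith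

/-- If the dual is strictly convex, two norm-one functionals that are bounded above on all the balls
with centre `z n` and radius `r + n` are equal, provided `z n` is within distance `n` of `z 0`:
both exceed `n - C`, with `C` constant, at the vector `z 0 - z n` of norm at most `n`. -/
theorem eq_of_bounded_on_balls [StrictConvexSpace ℝ (StrongDual ℝ X)] {z : ℕ → X} {r : ℝ}
    (hr : 0 < r) (hz : ∀ n, dist (z n) (z 0) ≤ n) {f g : StrongDual ℝ X} {a b : ℝ}
    (hf : ‖f‖ = 1) (hg : ‖g‖ = 1)
    (hfa : ∀ n : ℕ, ∀ y ∈ Metric.ball (z n) (r + n), f y ≤ a)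
    (hgb : ∀ n : ℕ, ∀ y ∈ Metric.ball (z n) (r + n), g y ≤ b) : f = g := by
  refine eq_of_norm_eq_of_norm_add_eq (hf.trans hg.symm) (le_antisymm (norm_add_le f g) ?_)
  rw [hf, hg]
  by_contra! hlt
  -- Evaluating `f + g` at `z 0 - z n` bounds `(2 - ‖f + g‖) * n` independently of `n`.
  obtain ⟨n, hn⟩ := exists_nat_gt ((a + b - f (z 0) - g (z 0)) / (1 + 1 - ‖f + g‖))
  rw [div_lt_iff₀ (by linarith)] at hn
  have h₁ := f.apply_add_norm_mul_le_of_ball (by positivity) (hfa n)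
  have h₂ := g.apply_add_norm_mul_le_of_ball (by positivity) (hgb n)
  have h₃ : (f + g) (z 0 - z n) ≤ ‖f + g‖ * n := by
    refine ((le_abs_self _).trans ((f + g).le_opNorm _)).trans ?_
    rw [← dist_eq_norm, dist_comm]
    gcongr
    exact hz n
  simp only [map_sub, add_apply] at h₃
  rw [hf] at h₁
  rw [hg] at h₂
  linarith

theorem exists_norm_eq_one_lt_of_notMem {U : Set X} (hU : Convex ℝ U) (ho : IsOpen U)
    (hne : U.Nonempty) {a : X} (ha : a ∉ U) :
    ∃ f : StrongDual ℝ X, ‖f‖ = 1 ∧ ∀ y ∈ U, f y < f a := by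
  obtain ⟨f, hf⟩ := geometric_hahn_banach_open_point hU ho ha
  obtain ⟨u, hu⟩ := hne
  have hf₀ : f ≠ 0 := by
    rintro rfl
    simpa using hf u hu
  have hpos : 0 < ‖f‖ := norm_pos_iff.2 hf₀
  refine ⟨‖f‖⁻¹ • f, norm_smul_inv_norm hf₀, fun y hy => ?_⟩
  simpa using mul_lt_mul_of_pos_left (hf y hy) (inv_pos.2 hpos)

/-- Vlasov's lemma: if the dual is strictly convex, the union of an increasing sequence of balls
whose radii tend to infinity has convex complement (it is a half-space or the whole space). -/
theorem convex_compl_iUnion_ball [StrictConvexSpace ℝ (StrongDual ℝ X)] {z : ℕ → X} {r : ℝ}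
    (hr : 0 < r) (hz : ∀ n, dist (z (n + 1)) (z n) ≤ 1) :
    Convex ℝ (⋃ n : ℕ, Metric.ball (z n) (r + n))ᶜ := by
  set U := ⋃ n : ℕ, Metric.ball (z n) (r + n)
  have hmono : Monotone fun n : ℕ => Metric.ball (z n) (r + n) :=
    monotone_nat_of_le_succ fun n => Metric.ball_subset_ball' <| by
      push_cast
      linarith [hz n, dist_comm (z (n + 1)) (z n)]
  have hU : Convex ℝ U := hmono.directed_le.convex_iUnion fun n => convex_ball _ _
  have ho : IsOpen U := isOpen_iUnion fun n => Metric.isOpen_ball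
  have hne : U.Nonempty := ⟨z 0, Set.mem_iUnion.2 ⟨0, by simpa using hr⟩⟩
  have hz₀ : ∀ n : ℕ, dist (z n) (z 0) ≤ n := fun n => by
    induction n with
    | zero => simp
    | succ n ih =>
      push_cast
      linarith [dist_triangle (z (n + 1)) (z n) (z 0), hz n]
  intro a ha b hb s t hs ht hst hmem
  obtain ⟨f, hf, hfa⟩ := exists_norm_eq_one_lt_of_notMem hU ho hne ha
  obtain ⟨g, hg, hgb⟩ := exists_norm_eq_one_lt_of_notMem hU ho hne hb
  obtain rfl : f = g := eq_of_bounded_on_balls hr hz₀ hf hg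
    (fun n y hy => (hfa y (Set.mem_iUnion.2 ⟨n, hy⟩)).le)
    (fun n y hy => (hgb y (Set.mem_iUnion.2 ⟨n, hy⟩)).le)
  have h₁ := hfa _ hmem
  have h₂ := hgb _ hmem
  simp only [map_add, map_smul, smul_eq_mul] at h₁ h₂
  obtain rfl : t = 1 - s := by linarith
  rcases le_total (f a) (f b) with h | h
  · linarith [mul_nonneg ht (sub_nonneg.2 h)]
  · linarith [mul_nonneg hs (sub_nonneg.2 h)]

end Vlasov

theorem IsChebyshevSet.isClosed {X : Type*} [NormedAddCommGroup X] {K : Set X}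
    (hK : IsChebyshevSet K) : IsClosed K := by
  refine isClosed_of_closure_subset fun x hx => ?_
  obtain ⟨p, ⟨hpK, hp⟩, -⟩ := hK x
  have hne : K.Nonempty := ⟨p, hpK⟩
  rw [(Metric.mem_closure_iff_infDist_zero hne).1 hx, norm_eq_zero, sub_eq_zero] at hp
  exact hp ▸ hpK

theorem mainTheorem5 {X : Type*} [NormedAddCommGroup X] [NormedSpace ℝ X] [CompleteSpace X]
    (hX : StrictConvexSpace ℝ (StrongDual ℝ X))
    (K : Set X) (hK : IsChebyshevSet K)
    (hDini : ∀ x : X, x ∉ K → ∀ p : X, IsNearestPoint K x p →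
      lowerDiniDist K x (x - p) = Metric.infDist x K) :
    Convex ℝ K := by
  intro a ha b hb s t hs ht hst
  by_contra hx
  set x := s • a + t • b
  have hd : 0 < Metric.infDist x K :=
    (hK.isClosed.notMem_iff_infDist_pos ⟨a, ha⟩).1 hx
  obtain ⟨r, hr, hrx⟩ := exists_between hd
  -- The centres, each carrying the lower bound for its distance to `K`.
  have hstep : ∀ (n : ℕ) (z : X), r + n < Metric.infDist z K →
      ∃ z', dist z' z ≤ 1 ∧ r + n + 1 < Metric.infDist z' K := fun n z hz =>
    exists_infDist_gt_add_one hK hDini (by positivity) hz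
  choose! next hnext₁ hnext₂ using hstep
  let z : ℕ → X := fun n => Nat.rec x (fun n z => next n z) n
  have hzd : ∀ n : ℕ, r + n < Metric.infDist (z n) K := fun n => by
    induction n with
    | zero => simpa [z] using hrx
    | succ n ih =>
      push_cast
      linarith [hnext₂ n (z n) ih]
  have hz : ∀ n, dist (z (n + 1)) (z n) ≤ 1 := fun n => hnext₁ n (z n) (hzd n)
  have hKU : K ⊆ (⋃ n : ℕ, Metric.ball (z n) (r + n))ᶜ := fun v hv hmem => by
    obtain ⟨n, hn⟩ := Set.mem_iUnion.1 hmem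
    linarith [hzd n, Metric.infDist_le_dist_of_mem (x := z n) hv, Metric.mem_ball'.1 hn]
  exact convex_compl_iUnion_ball hr hz (hKU ha) (hKU hb) hs ht hst
    (Set.mem_iUnion.2 ⟨0, Metric.mem_ball_self (by simpa using hr)⟩)
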